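/- Consider $L$ parallel many-server stations with unit service rates. For each $i=1,\dots,L$ let $\Omega_i$ be a finite set, and put $\Omega=\Omega_1\times\cdots\times\Omega_L$. Let $(p^\omega)_{\omega\in\Omega}$ be a probability distribution on $\Omega$, let $\Lambda_{0,i}^{s}>0$ ($s\in\Omega_i$) be base arrival rates, and for $m\in\mathbb N=\{1,2,\dots\}$ let $\Lambda_{m,i}^{s}=m\Lambda_{0,i}^{s}$. Let $\delta>0$ and, for every $i$ and $s\in\Omega_i$, let $c_i(\cdot,s)$ be continuous and strictly increasing on $[0,\infty)$. For real $n>\lambda>0$ let $$\bar\alpha(n,\lambda)=\left[\lambda\int_0^\infty t e^{-\lambda t}(1+t)^{n-1}\,dt\right]^{-1}$$ be the continuous Erlang-C formula and let $$U(n,\lambda)=\left[\rho+\gamma\left(\frac{\Phi(a)}{\phi(a)}+\frac{2}{3\sqrt n}\right)\right]^{-1},\qquad \rho=\frac{\lambda}{n},\quad \gamma=\frac{n-\lambda}{\sqrt n},\quad a=\sqrt{-2n(1-\rho+\ln\rho)},$$ be its Janssen--Van Leeuwaarden--Zwart upper bound, where $\phi$ and $\Phi$ are the standard normal density and distribution function.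 For $0<n\le\lambda$ (an overloaded station, where every customer waits) put $\bar\alpha(n,\lambda)=U(n,\lambda)=1$. A decision is a pair $(\beta,\omega^{key})$ with $\beta\in[0,\infty)^L$ and $\omega^{key}\in\Omega$; it gives station $i$, in every scenario, $n_i=\Lambda_{m,i}^{\omega_i^{key}}+\beta_i\sqrt{\Lambda_{m,i}^{\omega_i^{key}}}$ servers. Define the exact objective $$f_m(\beta,\omega^{key})=\sum_{i=1}^L c_i(\beta_i,\omega_i^{key})+\delta\left(1-\sum_{\omega\in\Omega}p^\omega\prod_{i=1}^L\left(1-\bar\alpha\left(n_i,\Lambda_{m,i}^{\omega_i}\right)\right)\right),$$ and let $g_m$ be the same expression with $U$ in place of $\bar\alpha$. Suppose that for every $m\in\mathbb N$, $(\beta_m^F,\omega_m^F)$ minimises $f_m$ and $(\beta_m^G,\omega_m^G)$ minimises $g_m$ over $[0,\infty)^L\times\Omega$. Then $$\lim_{m\to\infty}\left(f_m(\beta_m^G,\omega_m^G)-f_m(\beta_m^F,\omega_m^F)\right)=0.$$ -/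

import Mathlib

open MeasureTheory ProbabilityTheory

noncomputable section

namespace Staffing

/-- The continuous (Jagers--Van Doorn) extension of the Erlang-C formula to a real number `n` of
servers, with arrival rate `r` and service rate `1`. -/
def erlangC (n r : ℝ) : ℝ :=
  (r * ∫ t in Set.Ioi (0 : ℝ), t * Real.exp (-r * t) * (1 + t) ^ (n - 1))⁻¹

/-- Density of the standard normal distribution. -/
def stdPDF (x : ℝ) : ℝ := gaussianPDFReal 0 1 x

/-- Cumulative distribution function of the standard normal distribution. -/
def stdCDF (x : ℝ) : ℝ := cdf (gaussianReal 0 1) x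

/-- The Janssen--Van Leeuwaarden--Zwart upper bound on `erlangC n r` for `n > r`, in which
`r / n = ρ`, `(n - r) / √n = γ` and the local variable `a` is `√(-2 n (1 - ρ + log ρ))`. -/
def jvlzUpper (n r : ℝ) : ℝ :=
  let ρ := r / n
  let γ := (n - r) / √n
  let a := √(-2 * n * (1 - ρ + Real.log ρ))
  (ρ + γ * (stdCDF a / stdPDF a + 2 / (3 * √n)))⁻¹

/-- Stationary probability of waiting with `n` servers and arrival rate `r`: the continuous
Erlang-C formula if `n > r`; a station with `n ≤ r` is not stable and everybody waits. -/
def waitProb (n r : ℝ) : ℝ := if n ≤ r then 1 else erlangC n r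

/-- The approximation of `waitProb` in which the upper bound replaces the Erlang-C formula. -/
def waitUpper (n r : ℝ) : ℝ := if n ≤ r then 1 else jvlzUpper n r

/-- Square-root safety staffing level for the arrival rate `r` and the factor `b`. -/
def staffing (b r : ℝ) : ℝ := r + b * √r

/-- The dualised multi-station objective. The decision is a pair `x = (β, key)` of a vector of
safety factors and a key scenario; station `i` has `staffing (β i) (rate i (key i))` servers in
every scenario. `w n r` is the waiting probability that is used for a station with `n` servers
and arrival rate `r`, `p` the distribution of the scenarios and `rate` the arrival rates. -/
def objective {L : ℕ} {Ω : Fin L → Type*} [∀ i, Fintype (Ω i)] (w : ℝ → ℝ → ℝ)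
    (c : ∀ i, ℝ → Ω i → ℝ) (δ : ℝ) (p : (∀ i, Ω i) → ℝ) (rate : ∀ i, Ω i → ℝ)
    (x : (Fin L → ℝ) × (∀ i, Ω i)) : ℝ :=
  ∑ i, c i (x.1 i) (x.2 i) +
    δ * (1 - ∑ ω : (∀ i, Ω i),
      p ω * ∏ i, (1 - w (staffing (x.1 i) (rate i (x.2 i))) (rate i (ω i))))

/-- Objective of the exact model. -/
def exactObjective {L : ℕ} {Ω : Fin L → Type*} [∀ i, Fintype (Ω i)]
    (c : ∀ i, ℝ → Ω i → ℝ) (δ : ℝ) (p : (∀ i, Ω i) → ℝ) (rate : ∀ i, Ω i → ℝ) :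
    (Fin L → ℝ) × (∀ i, Ω i) → ℝ :=
  objective waitProb c δ p rate

/-- Objective of the approximate model. -/
def approxObjective {L : ℕ} {Ω : Fin L → Type*} [∀ i, Fintype (Ω i)]
    (c : ∀ i, ℝ → Ω i → ℝ) (δ : ℝ) (p : (∀ i, Ω i) → ℝ) (rate : ∀ i, Ω i → ℝ) :
    (Fin L → ℝ) × (∀ i, Ω i) → ℝ :=
  objective waitUpper c δ p rate

/-- `x` minimises `h` over all pairs of a nonnegative vector of safety factors and a scenario. -/
def IsOptimal {L : ℕ} {Ω : Fin L → Type*} (h : (Fin L → ℝ) × (∀ i, Ω i) → ℝ)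
    (x : (Fin L → ℝ) × (∀ i, Ω i)) : Prop :=
  (∀ i, 0 ≤ x.1 i) ∧ ∀ y : (Fin L → ℝ) × (∀ i, Ω i), (∀ i, 0 ≤ y.1 i) → h x ≤ h y

end Staffing

end

namespace Staffing

open Filter Topology Set Asymptotics

/-! ### The Erlang-C integral -/

/-! If `|f - g| ≤ η` at every decision, then optimality of each minimiser for its own objective
gives `0 ≤ f(xG) - f(xF) ≤ 2η`. So it suffices that the two waiting probabilities agree uniformly in
the number `n` of servers as the arrival rate `r → ∞` (`eventually_abs_waitProb_sub_waitUpper_le`);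
the costs cancel, and products of numbers in `[0, 1]` are 1-Lipschitz in each factor.

For `n > r`, write `ρ = r/n`, `γ = (n - r)/√n`. Integration by parts and Laplace rescaling put both
reciprocals in the same form, `ρ + γ e^{a²/2} ∫` plus, for the upper bound, `2γ/(3√n)`. The exact
formula integrates `laplaceDensity n` over `(-γ, ∞)`, the bound integrates `e^{-u²/2}` over `(-a,
∞)`. The densities converge in L¹, and changing `-γ` to `-a` costs `O(1/√n)`. The prefactor `γ
e^{a²/2}` is unbounded, but it is at most the reciprocal of the upper bound, so it disappears on
passing from reciprocals to probabilities (`abs_erlangC_sub_jvlzUpper_le`). The error depends on `n`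
alone, and `n > r`. -/

lemma isBigO_rpow_one_add_mul_exp {r : ℝ} (hr : 0 < r) (s : ℝ) :
    (fun t : ℝ => (1 + t) ^ s * Real.exp (-r * t)) =O[atTop]
      fun t => Real.exp (-(r / 2) * t) := by
  have h := (isLittleO_rpow_exp_pos_mul_atTop s (half_pos hr)).comp_tendsto
    (tendsto_atTop_add_const_left atTop (1 : ℝ) tendsto_id)
  have h2 := h.isBigO.mul (isBigO_refl (fun t : ℝ => Real.exp (-r * t)) atTop)
  refine h2.trans (IsBigO.of_bound (Real.exp (r / 2)) (Eventually.of_forall fun t => le_of_eq ?_))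
  simp only [Function.comp, id, Real.norm_eq_abs, Real.abs_exp, ← Real.exp_add]
  ring_nf

lemma continuousOn_rpow_one_add_mul_exp (r s : ℝ) :
    ContinuousOn (fun t : ℝ => (1 + t) ^ s * Real.exp (-r * t)) (Ici 0) := by
  refine ContinuousOn.mul (ContinuousOn.rpow_const (by fun_prop) fun t ht => Or.inl ?_)
    (by fun_prop)
  have : (0 : ℝ) ≤ t := ht
  positivity

lemma integrableOn_rpow_one_add_mul_exp {r : ℝ} (hr : 0 < r) (s : ℝ) :
    IntegrableOn (fun t : ℝ => (1 + t) ^ s * Real.exp (-r * t)) (Ioi 0) :=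
  integrable_of_isBigO_exp_neg (half_pos hr) (continuousOn_rpow_one_add_mul_exp r s)
    (isBigO_rpow_one_add_mul_exp hr s)

lemma tendsto_rpow_one_add_mul_exp {r : ℝ} (hr : 0 < r) (s : ℝ) :
    Tendsto (fun t : ℝ => (1 + t) ^ s * Real.exp (-r * t)) atTop (𝓝 0) := by
  refine (isBigO_rpow_one_add_mul_exp hr s).trans_tendsto (Real.tendsto_exp_atBot.comp ?_)
  exact tendsto_id.const_mul_atTop_of_neg (by linarith)

/-- The integrand is the derivative of `-(r/n) (1+t)^n e^{-rt}`, which vanishes at infinity. -/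
lemma integral_rpow_one_add_mul_exp_parts {n r : ℝ} (hr : 0 < r) (hn : 0 < n) :
    ∫ t in Ioi (0 : ℝ), (r * (t * Real.exp (-r * t) * (1 + t) ^ (n - 1)) -
      (1 - r / n) * r * ((1 + t) ^ n * Real.exp (-r * t))) = r / n := by
  have hpow : ∀ t : ℝ, 0 ≤ t → (1 + t) ^ n = (1 + t) ^ (n - 1) * (1 + t) := fun t ht => by
    rw [← Real.rpow_add_one (by positivity)]; ring_nf
  have hint : IntegrableOn (fun t : ℝ => r * (t * Real.exp (-r * t) * (1 + t) ^ (n - 1)) -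
      (1 - r / n) * r * ((1 + t) ^ n * Real.exp (-r * t))) (Ioi 0) := by
    have h := ((integrableOn_rpow_one_add_mul_exp hr n).const_mul (r * (r / n))).sub
      ((integrableOn_rpow_one_add_mul_exp hr (n - 1)).const_mul r)
    refine IntegrableOn.congr_fun h (fun t ht => ?_) measurableSet_Ioi
    simp only [Pi.sub_apply, hpow t (le_of_lt ht)]
    ring
  have h := integral_Ioi_of_hasDerivAt_of_tendsto'
    (f := fun t : ℝ => -(r / n) * ((1 + t) ^ n * Real.exp (-r * t))) (a := 0) (m := 0)
    (fun t ht => ?_) hint (by simpa using (tendsto_rpow_one_add_mul_exp hr n).const_mul (-(r / n)))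
  · rw [h]; simp
  · have ht : (0 : ℝ) ≤ t := ht
    have h1 : HasDerivAt (fun t : ℝ => (1 + t) ^ n) (1 * n * (1 + t) ^ (n - 1)) t :=
      ((hasDerivAt_id t).const_add 1).rpow_const (Or.inl (by simp; positivity))
    have h2 : HasDerivAt (fun t : ℝ => Real.exp (-r * t)) (Real.exp (-r * t) * (-r * 1)) t :=
      ((hasDerivAt_id t).const_mul (-r)).exp
    refine ((h1.mul h2).const_mul (-(r / n))).congr_deriv ?_
    rw [hpow t ht]
    field_simp
    ring

/-- Integration by parts in the Erlang-C formula. -/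
lemma inv_erlangC {n r : ℝ} (hr : 0 < r) (hn : 0 < n) :
    (erlangC n r)⁻¹ =
      r / n + (1 - r / n) * (r * ∫ t in Ioi (0 : ℝ), (1 + t) ^ n * Real.exp (-r * t)) := by
  have h := integral_rpow_one_add_mul_exp_parts hr hn
  have hint : IntegrableOn (fun t : ℝ => t * Real.exp (-r * t) * (1 + t) ^ (n - 1)) (Ioi 0) := by
    refine ((integrableOn_rpow_one_add_mul_exp hr n).sub
      (integrableOn_rpow_one_add_mul_exp hr (n - 1))).congr_fun (fun t ht => ?_) measurableSet_Ioi
    have ht : (0 : ℝ) < t := ht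
    have : (1 + t) ^ n = (1 + t) ^ (n - 1) * (1 + t) := by
      rw [← Real.rpow_add_one (by positivity)]; ring_nf
    simp only [Pi.sub_apply, this]
    ring
  rw [integral_sub (hint.const_mul r) ((integrableOn_rpow_one_add_mul_exp hr n).const_mul _),
    integral_const_mul, integral_const_mul] at h
  rw [erlangC, inv_inv]
  linarith

lemma one_le_mul_integral_rpow_one_add_mul_exp {n r : ℝ} (hr : 0 < r) (hn : 0 < n) :
    1 ≤ r * ∫ t in Ioi (0 : ℝ), (1 + t) ^ n * Real.exp (-r * t) := by
  have h0 : ∫ t in Ioi (0 : ℝ), Real.exp (-r * t) = 1 / r := by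
    rw [integral_exp_mul_Ioi (by linarith)]; simp
  have : 1 / r ≤ ∫ t in Ioi (0 : ℝ), (1 + t) ^ n * Real.exp (-r * t) := by
    rw [← h0]
    refine setIntegral_mono_on (exp_neg_integrableOn_Ioi 0 hr)
      (integrableOn_rpow_one_add_mul_exp hr n) measurableSet_Ioi fun t ht => ?_
    have ht : (0 : ℝ) < t := ht
    exact le_mul_of_one_le_left (Real.exp_pos _).le
      (Real.one_le_rpow (by linarith) hn.le)
  rwa [div_le_iff₀' hr] at this

/-! ### The integrand of the Laplace method -/

/-- The rescaled integrand `exp (-n (x - 1 - log x))` at `x = 1 + u / √n`. -/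
noncomputable def laplaceDensity (n u : ℝ) : ℝ :=
  (Ioi (-√n)).indicator (fun u => Real.exp (-u * √n + n * Real.log (1 + u / √n))) u

/-- The integral in the Erlang-C formula after rescaling around the maximum of the integrand. -/
lemma integral_rpow_one_add_mul_exp_eq_laplace {n r : ℝ} (hr : 0 < r) (hn : 0 < n) :
    r / √n * ∫ t in Ioi (0 : ℝ), (1 + t) ^ n * Real.exp (-r * t) =
      Real.exp (-n * (1 - r / n + Real.log (r / n))) *
        ∫ u in Ioi (-((n - r) / √n)), laplaceDensity n u := by
  have hs : 0 < √n := Real.sqrt_pos.2 hn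
  have hss : √n * √n = n := Real.mul_self_sqrt hn.le
  -- Substitute `t = (√n/r)(u + (n-r)/√n)`, so that `1 + t = (1 + u/√n)/ρ`; the dilation comes
  -- first, then the shift.
  have h1 := integral_comp_mul_left_Ioi
    (fun t : ℝ => (1 + t) ^ n * Real.exp (-r * t)) 0 (b := √n / r) (by positivity)
  rw [mul_zero, smul_eq_mul, inv_div] at h1
  rw [← h1]
  have h2 := (measurePreserving_add_right volume ((n - r) / √n)).setIntegral_preimage_emb
    (measurableEmbedding_addRight _)
    (fun x : ℝ => (1 + √n / r * x) ^ n * Real.exp (-r * (√n / r * x))) (Ioi 0)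
  have h3 : (fun x => x + (n - r) / √n) ⁻¹' Ioi 0 = Ioi (-((n - r) / √n)) := by
    ext x; simp [neg_lt_iff_pos_add]
  rw [h3] at h2
  rw [← h2, ← integral_const_mul]
  refine setIntegral_congr_fun measurableSet_Ioi fun u hu => ?_
  have hu : -((n - r) / √n) < u := hu
  have e1 : (n - r) / √n = √n - r / √n := by rw [sub_div, Real.div_sqrt]
  have hu2 : -√n < u := by
    have : 0 < r / √n := by positivity
    linarith
  have hpos : 0 < 1 + u / √n := by
    rw [show 1 + u / √n = (√n + u) / √n by field_simp]
    exact div_pos (by linarith) hs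
  have e2 : 1 + √n / r * (u + (n - r) / √n) = (1 + u / √n) / (r / n) := by
    -- With `√n` replaced by a free `s`, `rfl` eliminates `n` and leaves a rational identity.
    have : ∀ s : ℝ, 0 < s → s * s = n →
        1 + s / r * (u + (s - r / s)) = (1 + u / s) / (r / n) := by
      rintro s hs rfl
      field_simp
      ring
    rw [e1, this _ hs hss]
  simp only [laplaceDensity, indicator_of_mem (show u ∈ Ioi (-√n) from hu2)]
  rw [e2, Real.rpow_def_of_pos (by positivity), Real.log_div hpos.ne' (by positivity),
    ← Real.exp_add, ← Real.exp_add]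
  congr 1
  have : ∀ s x y : ℝ, 0 < s → s * s = n →
      (x - y) * n + -r * (s / r * (u + (s - r / s))) =
        -n * (1 - r / n + y) + (-u * s + n * x) := by
    rintro s x y hs rfl
    field_simp
    ring
  rw [e1, this _ _ _ hs hss]

/-! ### Bounds on the logarithm -/

lemma abs_log_one_sub_add_le {x : ℝ} (hx : |x| ≤ 1 / 2) :
    |x + x ^ 2 / 2 + Real.log (1 - x)| ≤ 2 * |x| ^ 3 := by
  have h := Real.abs_log_sub_add_sum_range_le (x := x) (by linarith) 2
  norm_num [Finset.sum_range_succ] at h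
  refine h.trans ?_
  rw [div_le_iff₀ (by linarith)]
  nlinarith [pow_nonneg (abs_nonneg x) 3]

/-- All terms of the series of `-log (1 - x)` are nonnegative; keep two. -/
lemma log_one_sub_le {x : ℝ} (h0 : 0 ≤ x) (h1 : x < 1) :
    Real.log (1 - x) ≤ -x - x ^ 2 / 2 := by
  have h := sum_le_hasSum (Finset.range 2) (fun i _ => by positivity)
    (Real.hasSum_pow_div_log_of_abs_lt_one (x := x) (by rwa [abs_of_nonneg h0]))
  norm_num [Finset.sum_range_succ] at h
  linarith

/-- This is `w ≤ sinh w` at `w = log (1 + v)`. -/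
lemma log_one_add_le {v : ℝ} (h0 : 0 ≤ v) :
    Real.log (1 + v) ≤ v - v ^ 2 / (2 * (1 + v)) := by
  have h := Real.self_le_sinh_iff.2 (Real.log_nonneg (show 1 ≤ 1 + v by linarith))
  rw [Real.sinh_log (by linarith)] at h
  refine h.trans (le_of_eq ?_)
  field_simp
  ring

/-! ### Convergence of the rescaled integrand to the Gaussian -/

lemma laplaceDensity_nonneg (n u : ℝ) : 0 ≤ laplaceDensity n u :=
  indicator_nonneg (fun _ _ => (Real.exp_pos _).le) _

lemma measurable_laplaceDensity (n : ℝ) : Measurable (laplaceDensity n) := by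
  unfold laplaceDensity
  exact Measurable.indicator (by fun_prop) measurableSet_Ioi

/-- An integrable bound on `laplaceDensity n` for all `n ≥ 1`. -/
noncomputable def laplaceBound (u : ℝ) : ℝ :=
  Real.exp (-(1 / 2) * u ^ 2) +
    (Ioi (-1)).indicator (fun u => Real.exp (-(1 / 2) * u) * Real.exp (1 / 2)) u

lemma integrable_laplaceBound : Integrable laplaceBound := by
  refine (integrable_exp_neg_mul_sq (by norm_num)).add ?_
  rw [integrable_indicator_iff measurableSet_Ioi]
  exact (exp_neg_integrableOn_Ioi (-1) (by norm_num)).mul_const _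

lemma laplaceDensity_le_bound {n : ℝ} (hn : 1 ≤ n) (u : ℝ) :
    laplaceDensity n u ≤ laplaceBound u := by
  have hs : 1 ≤ √n := Real.one_le_sqrt.2 hn
  have hss : √n * √n = n := Real.mul_self_sqrt (by linarith)
  by_cases hu : u ∈ Ioi (-√n)
  · rw [laplaceDensity, indicator_of_mem hu, laplaceBound]
    have hu' : -√n < u := hu
    generalize √n = s at *
    have hs0 : 0 < s := by linarith
    subst hss
    rcases lt_or_ge u 0 with h | h
    · have h1 := log_one_sub_le (x := -(u / s)) (neg_nonneg.2 (div_nonpos_of_nonpos_of_nonneg h.le hs0.le))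
        (by rw [← neg_div, div_lt_one hs0]; linarith)
      rw [sub_neg_eq_add] at h1
      refine le_add_of_le_of_nonneg (Real.exp_le_exp.2 ?_)
        (indicator_nonneg (fun _ _ => by positivity) _)
      have h2 := mul_le_mul_of_nonneg_left h1 (mul_pos hs0 hs0).le
      have h3 : s * s * (- -(u / s) - (-(u / s)) ^ 2 / 2) = u * s - u ^ 2 / 2 := by
        field_simp
      linarith
    -- For `u ≥ 0` the exponent is at most `-u²/(2(1 + u/√n))`, which is largest at `n = 1`; hence
    -- only exponential decay is uniform in `n`.
    · have h1 := log_one_add_le (v := u / s) (by positivity)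
      rw [indicator_of_mem (show u ∈ Ioi (-1 : ℝ) from lt_of_lt_of_le (by norm_num) h), ← Real.exp_add]
      refine le_add_of_nonneg_of_le (Real.exp_pos _).le (Real.exp_le_exp.2 ?_)
      have h2 := mul_le_mul_of_nonneg_left h1 (mul_pos hs0 hs0).le
      have h3 : s * s * (u / s - (u / s) ^ 2 / (2 * (1 + u / s))) =
          u * s - u ^ 2 / (2 * (1 + u / s)) := by
        field_simp
      have h4 : u ^ 2 / (2 * (1 + u)) ≤ u ^ 2 / (2 * (1 + u / s)) := by
        gcongr
        exact div_le_self h hs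
      have h5 : (u - 1) / 2 ≤ u ^ 2 / (2 * (1 + u)) := by
        rw [div_le_div_iff₀ (by norm_num) (by positivity)]
        nlinarith
      linarith
  · rw [laplaceDensity, indicator_of_notMem hu]
    exact add_nonneg (Real.exp_pos _).le (indicator_nonneg (fun _ _ => by positivity) _)

lemma integrable_laplaceDensity {n : ℝ} (hn : 1 ≤ n) : Integrable (laplaceDensity n) :=
  integrable_laplaceBound.mono' (measurable_laplaceDensity n).aestronglyMeasurable
    (Eventually.of_forall fun u => by
      rw [Real.norm_of_nonneg (laplaceDensity_nonneg n u)]; exact laplaceDensity_le_bound hn u)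

lemma tendsto_laplaceDensity (u : ℝ) :
    Tendsto (fun n => laplaceDensity n u) atTop (𝓝 (Real.exp (-(1 / 2) * u ^ 2))) := by
  have key : Tendsto (fun n : ℝ => -u * √n + n * Real.log (1 + u / √n)) atTop
      (𝓝 (-(1 / 2) * u ^ 2)) := by
    rw [tendsto_iff_dist_tendsto_zero]
    refine squeeze_zero' (g := fun n : ℝ => 2 * |u| ^ 3 / √n)
      (Eventually.of_forall fun _ => dist_nonneg) ?_
      (tendsto_const_nhds.div_atTop Real.tendsto_sqrt_atTop)
    -- This gives `|u|/√n ≤ 1/2`, as the Taylor bound requires; the `+ 1` keeps `√n` positive.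
    filter_upwards [Real.tendsto_sqrt_atTop.eventually_ge_atTop (2 * |u| + 1),
      eventually_ge_atTop 0] with n h1 hn
    have hss : √n * √n = n := Real.mul_self_sqrt hn
    generalize √n = s at *
    subst hss
    have hs : 0 < s := by linarith [abs_nonneg u]
    have h2 := abs_log_one_sub_add_le (x := -(u / s)) (by
      rw [abs_neg, abs_div, abs_of_pos hs, div_le_iff₀ hs]; linarith)
    rw [sub_neg_eq_add, abs_neg, abs_div, abs_of_pos hs] at h2
    have h3 := mul_le_mul_of_nonneg_left h2 (mul_pos hs hs).le
    nth_rewrite 1 [← abs_of_pos (mul_pos hs hs)] at h3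
    rw [← abs_mul] at h3
    rw [Real.dist_eq]
    have e1 : -u * s + s * s * Real.log (1 + u / s) - -(1 / 2) * u ^ 2 =
        s * s * (-(u / s) + (-(u / s)) ^ 2 / 2 + Real.log (1 + u / s)) := by
      generalize Real.log (1 + u / s) = y
      field_simp
      ring
    have e2 : 2 * |u| ^ 3 / s = s * s * (2 * (|u| / s) ^ 3) := by field_simp
    rw [e1, e2]
    exact h3
  refine ((Real.continuous_exp.tendsto _).comp key).congr' ?_
  filter_upwards [Real.tendsto_sqrt_atTop.eventually_gt_atTop (-u)] with n hn
  rw [laplaceDensity, indicator_of_mem (show u ∈ Ioi (-√n) from by simp only [mem_Ioi]; linarith)]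
  rfl

/-- The L¹ distance controls the integrals over all half-lines at once, whence uniformity in `r`. -/
lemma tendsto_integral_abs_laplaceDensity_sub :
    Tendsto (fun n => ∫ u, |laplaceDensity n u - Real.exp (-(1 / 2) * u ^ 2)|) atTop (𝓝 0) := by
  have hG : Integrable (fun u : ℝ => Real.exp (-(1 / 2) * u ^ 2)) :=
    integrable_exp_neg_mul_sq (by norm_num)
  have h := tendsto_integral_filter_of_dominated_convergence (μ := volume) (l := (atTop : Filter ℝ))
    (F := fun n u => |laplaceDensity n u - Real.exp (-(1 / 2) * u ^ 2)|) (f := fun _ => (0 : ℝ))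
    (fun u => laplaceBound u + Real.exp (-(1 / 2) * u ^ 2)) ?_ ?_
    (integrable_laplaceBound.add hG) ?_
  · simpa using h
  · refine Eventually.of_forall fun n => Measurable.aestronglyMeasurable ?_
    have := measurable_laplaceDensity n
    fun_prop
  · filter_upwards [eventually_ge_atTop 1] with n hn
    refine Eventually.of_forall fun u => ?_
    rw [Real.norm_eq_abs, abs_abs]
    have h1 := laplaceDensity_le_bound hn u
    have h2 := laplaceDensity_nonneg n u
    have h3 := Real.exp_pos (-(1 / 2) * u ^ 2)
    rw [abs_le]
    constructor <;> linarith
  · refine Eventually.of_forall fun u => ?_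
    have := ((tendsto_laplaceDensity u).sub_const (Real.exp (-(1 / 2) * u ^ 2))).abs
    simpa using this

lemma abs_integral_laplaceDensity_sub_le {n : ℝ} (hn : 1 ≤ n) (b : ℝ) :
    |(∫ u in Ioi b, laplaceDensity n u) - ∫ u in Ioi b, Real.exp (-(1 / 2) * u ^ 2)| ≤
      ∫ u, |laplaceDensity n u - Real.exp (-(1 / 2) * u ^ 2)| := by
  have hG : Integrable (fun u : ℝ => Real.exp (-(1 / 2) * u ^ 2)) :=
    integrable_exp_neg_mul_sq (by norm_num)
  have hq := integrable_laplaceDensity hn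
  rw [← integral_sub hq.integrableOn hG.integrableOn]
  refine abs_integral_le_integral_abs.trans ?_
  exact setIntegral_le_integral (hq.sub hG).abs (Eventually.of_forall fun _ => abs_nonneg _)

/-! ### The Gaussian side -/

/-- The argument `√(-2 n (1 - ρ + log ρ))` of the normal distribution function in `jvlzUpper`. -/
noncomputable def jvlzArg (n r : ℝ) : ℝ := √(-2 * n * (1 - r / n + Real.log (r / n)))

lemma jvlzArg_nonneg (n r : ℝ) : 0 ≤ jvlzArg n r := Real.sqrt_nonneg _

lemma stdPDF_eq (x : ℝ) : stdPDF x = (√(2 * Real.pi))⁻¹ * Real.exp (-(1 / 2) * x ^ 2) := by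
  simp only [stdPDF, gaussianPDFReal_def, NNReal.coe_one, mul_one, sub_zero]
  ring_nf

lemma stdCDF_eq (a : ℝ) :
    stdCDF a = (√(2 * Real.pi))⁻¹ * ∫ u in Ioi (-a), Real.exp (-(1 / 2) * u ^ 2) := by
  rw [stdCDF, cdf_eq_real, measureReal_def, gaussianReal_apply_eq_integral _ one_ne_zero,
    ENNReal.toReal_ofReal (integral_nonneg fun _ => gaussianPDFReal_nonneg _ _ _),
    ← integral_comp_neg_Iic, ← integral_const_mul]
  refine setIntegral_congr_fun measurableSet_Iic fun x _ => ?_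
  change stdPDF x = _
  rw [stdPDF_eq, neg_sq]

lemma stdCDF_div_stdPDF (a : ℝ) :
    stdCDF a / stdPDF a =
      Real.exp (1 / 2 * a ^ 2) * ∫ u in Ioi (-a), Real.exp (-(1 / 2) * u ^ 2) := by
  rw [stdCDF_eq, stdPDF_eq, neg_mul, Real.exp_neg]
  have : 0 < √(2 * Real.pi) := by positivity
  field_simp

lemma one_le_integral_Ioi_neg_gaussian {a : ℝ} (ha : 0 ≤ a) :
    1 ≤ ∫ u in Ioi (-a), Real.exp (-(1 / 2) * u ^ 2) := by
  have h1 : 1 ≤ ∫ u in Ioi (0 : ℝ), Real.exp (-(1 / 2) * u ^ 2) := by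
    rw [integral_gaussian_Ioi, le_div_iff₀ (by norm_num)]
    refine Real.le_sqrt_of_sq_le ?_
    have := Real.pi_gt_three
    rw [le_div_iff₀ (by norm_num)]
    linarith
  refine h1.trans (setIntegral_mono_set (integrable_exp_neg_mul_sq (by norm_num)).integrableOn
    (Eventually.of_forall fun _ => (Real.exp_pos _).le) (Ioi_subset_Ioi (by linarith)).eventuallyLE)

lemma integral_Ioi_gaussian_le_inv {b : ℝ} (hb : 0 < b) :
    ∫ u in Ioi b, Real.exp (-(1 / 2) * u ^ 2) ≤ 2 / b := by
  have h : ∫ u in Ioi b, Real.exp (-(b / 2) * u) = Real.exp (-(b / 2) * b) / (b / 2) := by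
    rw [integral_exp_mul_Ioi (by linarith), neg_div, div_neg, neg_neg]
  calc ∫ u in Ioi b, Real.exp (-(1 / 2) * u ^ 2)
      ≤ ∫ u in Ioi b, Real.exp (-(b / 2) * u) := by
        refine setIntegral_mono_on (integrable_exp_neg_mul_sq (by norm_num)).integrableOn
          (exp_neg_integrableOn_Ioi b (by positivity)) measurableSet_Ioi fun u hu => ?_
        have hu : b < u := hu
        refine Real.exp_le_exp.2 ?_
        nlinarith
    _ ≤ 1 / (b / 2) := by
        rw [h]
        gcongr
        rw [Real.exp_le_one_iff]
        nlinarith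
    _ = 2 / b := by field_simp

/-- Symmetry of the Gaussian moves the difference to the right tail. -/
lemma integral_Ioi_neg_gaussian_sub {b a : ℝ} (hab : b ≤ a) :
    (∫ u in Ioi (-a), Real.exp (-(1 / 2) * u ^ 2)) - ∫ u in Ioi (-b), Real.exp (-(1 / 2) * u ^ 2) =
      (∫ u in Ioi b, Real.exp (-(1 / 2) * u ^ 2)) - ∫ u in Ioi a, Real.exp (-(1 / 2) * u ^ 2) := by
  have hG : Integrable (fun u : ℝ => Real.exp (-(1 / 2) * u ^ 2)) :=
    integrable_exp_neg_mul_sq (by norm_num)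
  rw [intervalIntegral.integral_Ioi_sub_Ioi hG.integrableOn (neg_le_neg hab),
    intervalIntegral.integral_Ioi_sub_Ioi hG.integrableOn hab,
    ← intervalIntegral.integral_comp_neg]
  simp

/-- Replacing the limit of integration `γ` by `jvlzArg` costs only `O(1 / √n)`, uniformly. -/
lemma abs_integral_gaussian_sub_le {n r : ℝ} (hr : 0 < r) (hrn : r < n) :
    |(∫ u in Ioi (-((n - r) / √n)), Real.exp (-(1 / 2) * u ^ 2)) -
      ∫ u in Ioi (-jvlzArg n r), Real.exp (-(1 / 2) * u ^ 2)| ≤ 4 / √n := by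
  have hn : 0 < n := hr.trans hrn
  have hG : Integrable (fun u : ℝ => Real.exp (-(1 / 2) * u ^ 2)) :=
    integrable_exp_neg_mul_sq (by norm_num)
  have hs : 0 < √n := Real.sqrt_pos.2 hn
  have hss : √n * √n = n := Real.mul_self_sqrt hn.le
  set x := 1 - r / n with hx
  have hρ : 0 < r / n := by positivity
  have hρ1 : r / n < 1 := (div_lt_one hn).2 hrn
  have hx0 : 0 < x := by linarith
  have hx1 : x < 1 := by linarith
  have hb : (n - r) / √n = √n * x := by
    rw [hx]
    have : ∀ s : ℝ, 0 < s → s * s = n → (n - r) / s = s * (1 - r / n) := by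
      rintro s hs rfl
      field_simp
    exact this _ hs hss
  have hρx : r / n = 1 - x := by ring
  have hlog := log_one_sub_le hx0.le hx1
  have ha2 : jvlzArg n r ^ 2 = -2 * n * (x + Real.log (1 - x)) := by
    rw [jvlzArg, Real.sq_sqrt, ← hx, hρx]
    rw [← hx, hρx]
    nlinarith [sq_nonneg x]
  have ha0 := jvlzArg_nonneg n r
  have hb0 : 0 < √n * x := by positivity
  have hb2 : (√n * x) ^ 2 = n * x ^ 2 := by rw [mul_pow, Real.sq_sqrt hn.le]
  have hab : √n * x ≤ jvlzArg n r := by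
    refine (sq_le_sq₀ hb0.le ha0).1 ?_
    rw [ha2, hb2]
    nlinarith
  rw [hb, abs_sub_comm, integral_Ioi_neg_gaussian_sub hab]
  have hnn : ∀ c : ℝ, 0 ≤ ∫ u in Ioi c, Real.exp (-(1 / 2) * u ^ 2) :=
    fun c => integral_nonneg fun _ => (Real.exp_pos _).le
  -- For small `x`, `a² - γ² ≤ 4nx³` gives `a - γ ≤ 2γ²/√n`, and the factor `e^{-γ²/2}` absorbs
  -- `γ²`. For `x ≥ 1/2`, `γ ≥ √n/2` and the whole tail beyond `γ` is small.
  rcases le_total x (1 / 2) with h | h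
  · rw [intervalIntegral.integral_Ioi_sub_Ioi hG.integrableOn hab]
    have h1 := intervalIntegral.norm_integral_le_of_norm_le_const (a := √n * x)
      (b := jvlzArg n r) (f := fun u => Real.exp (-(1 / 2) * u ^ 2))
      (C := Real.exp (-(1 / 2) * (√n * x) ^ 2)) (fun u hu => by
        rw [uIoc_of_le hab] at hu
        rw [Real.norm_eq_abs, Real.abs_exp, Real.exp_le_exp]
        nlinarith [hu.1])
    rw [Real.norm_eq_abs, abs_of_nonneg (sub_nonneg.2 hab)] at h1
    refine h1.trans ?_
    have h2 := abs_log_one_sub_add_le (x := x) (by rwa [abs_of_pos hx0])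
    rw [abs_of_pos hx0] at h2
    have h3 : jvlzArg n r - √n * x ≤ 2 * (√n * x) ^ 2 / √n := by
      have h4 : (jvlzArg n r - √n * x) * (√n * x) ≤ 2 * (√n * x) ^ 2 / √n * (√n * x) := by
        have h5 : 2 * (√n * x) ^ 2 / √n * (√n * x) = 2 * n * x ^ 3 := by
          rw [hb2]; field_simp
        rw [h5]
        have h6 : n * (x + x ^ 2 / 2 + Real.log (1 - x)) ≥ n * (-(2 * x ^ 3)) :=
          mul_le_mul_of_nonneg_left (abs_le.1 h2).1 hn.le
        have h7 : jvlzArg n r ^ 2 - (√n * x) ^ 2 ≤ 4 * n * x ^ 3 := by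
          rw [ha2, hb2]; linarith
        nlinarith [mul_nonneg (sub_nonneg.2 hab) (sub_nonneg.2 hab)]
      exact le_of_mul_le_mul_right h4 hb0
    have h8 := Real.mul_exp_neg_le_exp_neg_one (1 / 2 * (√n * x) ^ 2)
    have h9 : Real.exp (-1) ≤ 1 := Real.exp_le_one_iff.2 (by norm_num)
    rw [← neg_mul] at h8
    calc Real.exp (-(1 / 2) * (√n * x) ^ 2) * (jvlzArg n r - √n * x)
        ≤ Real.exp (-(1 / 2) * (√n * x) ^ 2) * (2 * (√n * x) ^ 2 / √n) := by gcongr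
      _ = 4 * (1 / 2 * (√n * x) ^ 2 * Real.exp (-(1 / 2) * (√n * x) ^ 2)) / √n := by ring
      _ ≤ 4 / √n := by gcongr; linarith
  · have h1 := integral_Ioi_gaussian_le_inv hb0
    have h2 := hnn (jvlzArg n r)
    have h3 : ∫ u in Ioi (jvlzArg n r), Real.exp (-(1 / 2) * u ^ 2) ≤
        ∫ u in Ioi (√n * x), Real.exp (-(1 / 2) * u ^ 2) :=
      setIntegral_mono_set hG.integrableOn
        (Eventually.of_forall fun _ => (Real.exp_pos _).le) (Ioi_subset_Ioi hab).eventuallyLE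
    have h4 : 2 / (√n * x) ≤ 4 / √n := by
      rw [div_le_div_iff₀ hb0 hs]
      nlinarith
    rw [abs_of_nonneg (by linarith)]
    linarith

/-! ### Uniform convergence of the waiting probabilities -/

/-- `erlangC` in the form of `jvlzUpper`. -/
lemma inv_erlangC_eq_laplace {n r : ℝ} (hr : 0 < r) (hrn : r < n) :
    (erlangC n r)⁻¹ = r / n + (n - r) / √n * (Real.exp (1 / 2 * jvlzArg n r ^ 2) *
      ∫ u in Ioi (-((n - r) / √n)), laplaceDensity n u) := by
  have hn : 0 < n := hr.trans hrn
  have hs : 0 < √n := Real.sqrt_pos.2 hn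
  have hss : √n * √n = n := Real.mul_self_sqrt hn.le
  have hlog := Real.log_le_sub_one_of_pos (show 0 < r / n by positivity)
  have ha : 1 / 2 * jvlzArg n r ^ 2 = -n * (1 - r / n + Real.log (r / n)) := by
    rw [jvlzArg, Real.sq_sqrt (by nlinarith)]; ring
  rw [ha, ← integral_rpow_one_add_mul_exp_eq_laplace hr hn, inv_erlangC hr hn]
  have : ∀ s J : ℝ, 0 < s → s * s = n → (1 - r / n) * (r * J) = (n - r) / s * (r / s * J) := by
    rintro s J hs rfl
    field_simp
  rw [this _ _ hs hss]

lemma inv_jvlzUpper (n r : ℝ) :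
    (jvlzUpper n r)⁻¹ = r / n + (n - r) / √n * (Real.exp (1 / 2 * jvlzArg n r ^ 2) *
      (∫ u in Ioi (-jvlzArg n r), Real.exp (-(1 / 2) * u ^ 2)) + 2 / (3 * √n)) := by
  rw [← stdCDF_div_stdPDF]
  simp only [jvlzUpper, inv_inv, jvlzArg]

lemma one_le_inv_erlangC {n r : ℝ} (hr : 0 < r) (hrn : r < n) : 1 ≤ (erlangC n r)⁻¹ := by
  have hn : 0 < n := hr.trans hrn
  rw [inv_erlangC hr hn]
  have h := one_le_mul_integral_rpow_one_add_mul_exp hr hn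
  have hρ1 : r / n < 1 := (div_lt_one hn).2 hrn
  nlinarith

/-- As `n ≥ 1`, `√n ≤ n` and so `γ ≥ 1 - ρ`, while its cofactor is at least 1. -/
lemma one_le_inv_jvlzUpper {n r : ℝ} (hr : 1 ≤ r) (hrn : r < n) : 1 ≤ (jvlzUpper n r)⁻¹ := by
  have hn : 0 < n := by linarith
  have hs : 1 ≤ √n := Real.one_le_sqrt.2 (by linarith)
  rw [inv_jvlzUpper]
  have h1 := one_le_integral_Ioi_neg_gaussian (jvlzArg_nonneg n r)
  have h2 : 1 ≤ Real.exp (1 / 2 * jvlzArg n r ^ 2) := Real.one_le_exp (by positivity)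
  have h3 := one_le_mul_of_one_le_of_one_le h2 h1
  have h4 : 0 ≤ 2 / (3 * √n) := by positivity
  have h5 : (n - r) / n ≤ (n - r) / √n := by
    refine div_le_div_of_nonneg_left (by linarith) (by linarith) ?_
    exact Real.sqrt_le_self_iff.2 (Or.inr (by linarith))
  have h6 : 0 ≤ (n - r) / √n := div_nonneg (by linarith) (by linarith)
  have h7 : r / n + (n - r) / n = 1 := by field_simp; ring
  nlinarith

lemma waitProb_mem_Icc {n r : ℝ} (hr : 0 < r) : waitProb n r ∈ Icc (0 : ℝ) 1 := by
  unfold waitProb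
  split_ifs with h
  · simp
  · have := one_le_inv_erlangC hr (not_le.1 h)
    have h0 : 0 < erlangC n r := inv_pos.1 (by linarith)
    exact ⟨h0.le, (one_le_inv₀ h0).1 this⟩

lemma waitUpper_mem_Icc {n r : ℝ} (hr : 1 ≤ r) : waitUpper n r ∈ Icc (0 : ℝ) 1 := by
  unfold waitUpper
  split_ifs with h
  · simp
  · have := one_le_inv_jvlzUpper hr (not_le.1 h)
    have h0 : 0 < jvlzUpper n r := inv_pos.1 (by linarith)
    exact ⟨h0.le, (one_le_inv₀ h0).1 this⟩

lemma abs_erlangC_sub_jvlzUpper_le {n r : ℝ} (hr : 1 ≤ r) (hrn : r < n) :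
    |erlangC n r - jvlzUpper n r| ≤
      (∫ u, |laplaceDensity n u - Real.exp (-(1 / 2) * u ^ 2)|) + 5 / √n := by
  have hr0 : 0 < r := by linarith
  have hs : 0 < √n := Real.sqrt_pos.2 (by linarith)
  have hA := one_le_inv_erlangC hr0 hrn
  have hB := one_le_inv_jvlzUpper hr hrn
  have hA0 : 0 < erlangC n r := inv_pos.1 (by linarith)
  have hB0 : 0 < jvlzUpper n r := inv_pos.1 (by linarith)
  have hA1 : erlangC n r ≤ 1 := (one_le_inv₀ hA0).1 hA
  have hAeq := inv_erlangC_eq_laplace hr0 hrn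
  have hBeq := inv_jvlzUpper n r
  have h1 := abs_integral_laplaceDensity_sub_le (n := n) (by linarith) (-((n - r) / √n))
  have h2 := abs_integral_gaussian_sub_le hr0 hrn
  have h3 := one_le_integral_Ioi_neg_gaussian (jvlzArg_nonneg n r)
  set D := ∫ u, |laplaceDensity n u - Real.exp (-(1 / 2) * u ^ 2)|
  set Q := ∫ u in Ioi (-((n - r) / √n)), laplaceDensity n u
  set K := ∫ u in Ioi (-((n - r) / √n)), Real.exp (-(1 / 2) * u ^ 2)
  set G := ∫ u in Ioi (-jvlzArg n r), Real.exp (-(1 / 2) * u ^ 2)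
  set E := Real.exp (1 / 2 * jvlzArg n r ^ 2)
  have hE : 1 ≤ E := Real.one_le_exp (by positivity)
  have hγ : 0 ≤ (n - r) / √n := div_nonneg (by linarith) hs.le
  have hρ : 0 ≤ r / n := div_nonneg hr0.le (by linarith)
  have h5 : 0 ≤ 1 / √n := by positivity
  have e4 : 4 / √n = 4 * (1 / √n) := by ring
  have e5 : 5 / √n = 5 * (1 / √n) := by ring
  have e23 : 2 / (3 * √n) = 2 / 3 * (1 / √n) := by field_simp
  rw [e23] at hBeq
  rw [e4] at h2
  rw [e5]
  have hD : 0 ≤ D := (abs_nonneg _).trans h1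
  generalize 1 / √n = κ at *
  generalize (n - r) / √n = γ at *
  have h4 : |Q - G| ≤ D + 4 * κ := by
    have := abs_sub_le Q K G
    linarith
  -- The constant 5 rounds up `4 + 2/3`; `E ≥ 1` lets the correction term share the factor `E`.
  have h6 : |E * Q - (E * G + 2 / 3 * κ)| ≤ E * (D + 5 * κ) := by
    have h7 := mul_le_mul_of_nonneg_left (abs_le.1 h4).1 (by linarith : 0 ≤ E)
    have h8 := mul_le_mul_of_nonneg_left (abs_le.1 h4).2 (by linarith : 0 ≤ E)
    have h9 : κ ≤ E * κ := le_mul_of_one_le_left h5 hE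
    rw [abs_le]
    constructor <;> linarith
  have h10 : |(jvlzUpper n r)⁻¹ - (erlangC n r)⁻¹| ≤ (D + 5 * κ) * (jvlzUpper n r)⁻¹ := by
    have h11 : (jvlzUpper n r)⁻¹ - (erlangC n r)⁻¹ = -(γ * (E * Q - (E * G + 2 / 3 * κ))) := by
      rw [hAeq, hBeq]; ring
    rw [h11, abs_neg, abs_mul, abs_of_nonneg hγ]
    -- Since `G ≥ 1`, the unbounded prefactor is dominated by the reciprocal, which cancels below.
    have h12 : γ * E ≤ (jvlzUpper n r)⁻¹ := by
      have : E * 1 ≤ E * G := mul_le_mul_of_nonneg_left h3 (by linarith)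
      have h13 : γ * E ≤ γ * (E * G + 2 / 3 * κ) := mul_le_mul_of_nonneg_left (by linarith) hγ
      rw [hBeq]; linarith
    calc γ * |E * Q - (E * G + 2 / 3 * κ)| ≤ γ * (E * (D + 5 * κ)) := by gcongr
      _ = (D + 5 * κ) * (γ * E) := by ring
      _ ≤ _ := by gcongr
  have h14 : erlangC n r - jvlzUpper n r =
      erlangC n r * jvlzUpper n r * ((jvlzUpper n r)⁻¹ - (erlangC n r)⁻¹) := by
    field_simp
  rw [h14, abs_mul, abs_of_pos (mul_pos hA0 hB0)]
  calc erlangC n r * jvlzUpper n r * |(jvlzUpper n r)⁻¹ - (erlangC n r)⁻¹|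
      ≤ erlangC n r * jvlzUpper n r * ((D + 5 * κ) * (jvlzUpper n r)⁻¹) := by gcongr
    _ = erlangC n r * (D + 5 * κ) := by field_simp
    _ ≤ 1 * (D + 5 * κ) := by gcongr
    _ = _ := one_mul _

/-- The upper bound approximates the waiting probability uniformly in the number of servers. -/
lemma eventually_abs_waitProb_sub_waitUpper_le {ε : ℝ} (hε : 0 < ε) :
    ∀ᶠ r in atTop, ∀ n, |waitProb n r - waitUpper n r| ≤ ε := by
  have h : Tendsto (fun n : ℝ => (∫ u, |laplaceDensity n u - Real.exp (-(1 / 2) * u ^ 2)|) +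
      5 / √n) atTop (𝓝 0) := by
    simpa using tendsto_integral_abs_laplaceDensity_sub.add
      ((tendsto_const_nhds (x := (5 : ℝ))).div_atTop Real.tendsto_sqrt_atTop)
  -- A threshold for `n` serves as one for `r`, because only `n > r` matters.
  obtain ⟨R, hR⟩ := eventually_atTop.1 (h.eventually_le_const hε)
  filter_upwards [eventually_ge_atTop R, eventually_ge_atTop 1] with r h1 h2 n
  unfold waitProb waitUpper
  split_ifs with hn
  · simpa using hε.le
  · rw [not_le] at hn
    exact (abs_erlangC_sub_jvlzUpper_le h2 hn).trans (hR n (by linarith))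

/-! ### Comparison of the objectives -/

/-- Exchange the factors one at a time; the remaining factors have modulus at most 1. -/
lemma abs_prod_sub_prod_le {ι : Type*} (s : Finset ι) {x y : ι → ℝ}
    (hx : ∀ i, x i ∈ Icc (0 : ℝ) 1) (hy : ∀ i, y i ∈ Icc (0 : ℝ) 1) :
    |∏ i ∈ s, x i - ∏ i ∈ s, y i| ≤ ∑ i ∈ s, |x i - y i| := by
  classical
  induction s using Finset.induction_on with
  | empty => simp
  | insert j s hj ih =>
    rw [Finset.prod_insert hj, Finset.prod_insert hj, Finset.sum_insert hj]
    have hp0 : 0 ≤ ∏ i ∈ s, x i := Finset.prod_nonneg fun i _ => (hx i).1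
    have hp1 : ∏ i ∈ s, x i ≤ 1 := Finset.prod_le_one (fun i _ => (hx i).1) fun i _ => (hx i).2
    calc |x j * ∏ i ∈ s, x i - y j * ∏ i ∈ s, y i|
        = |(x j - y j) * ∏ i ∈ s, x i + y j * (∏ i ∈ s, x i - ∏ i ∈ s, y i)| := by ring_nf
      _ ≤ |x j - y j| * ∏ i ∈ s, x i + y j * |∏ i ∈ s, x i - ∏ i ∈ s, y i| := by
          refine (abs_add_le _ _).trans (le_of_eq ?_)
          rw [abs_mul, abs_mul, abs_of_nonneg hp0, abs_of_nonneg (hy j).1]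
      _ ≤ |x j - y j| * 1 + 1 * |∏ i ∈ s, x i - ∏ i ∈ s, y i| := by
          gcongr
          exact (hy j).2
      _ ≤ _ := by linarith

lemma abs_objective_sub_objective_le {L : ℕ} {Ω : Fin L → Type*} [∀ i, Fintype (Ω i)]
    {w w' : ℝ → ℝ → ℝ} (c : ∀ i, ℝ → Ω i → ℝ) {δ ε : ℝ} (hδ : 0 ≤ δ) {p : (∀ i, Ω i) → ℝ}
    (hp_nonneg : ∀ ω, 0 ≤ p ω) (hp_sum : ∑ ω, p ω = 1) (rate : ∀ i, Ω i → ℝ)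
    (hw : ∀ i s n, w n (rate i s) ∈ Icc (0 : ℝ) 1)
    (hw' : ∀ i s n, w' n (rate i s) ∈ Icc (0 : ℝ) 1)
    (hε : ∀ i s n, |w n (rate i s) - w' n (rate i s)| ≤ ε)
    (x : (Fin L → ℝ) × (∀ i, Ω i)) :
    |objective w c δ p rate x - objective w' c δ p rate x| ≤ δ * (L * ε) := by
  have e : objective w c δ p rate x - objective w' c δ p rate x = δ * ∑ ω, p ω *
      (∏ i, (1 - w' (staffing (x.1 i) (rate i (x.2 i))) (rate i (ω i))) -
        ∏ i, (1 - w (staffing (x.1 i) (rate i (x.2 i))) (rate i (ω i)))) := by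
    simp only [objective, mul_sub, Finset.sum_sub_distrib]
    ring
  rw [e, abs_mul, abs_of_nonneg hδ]
  gcongr
  refine (Finset.abs_sum_le_sum_abs _ _).trans ?_
  calc _ ≤ ∑ ω, p ω * (L * ε) := Finset.sum_le_sum fun ω _ => ?_
    _ = L * ε := by rw [← Finset.sum_mul, hp_sum, one_mul]
  rw [abs_mul, abs_of_nonneg (hp_nonneg ω)]
  refine mul_le_mul_of_nonneg_left ?_ (hp_nonneg ω)
  refine (abs_prod_sub_prod_le _ (fun i => ?_) fun i => ?_).trans ?_
  · have := hw' i (ω i) (staffing (x.1 i) (rate i (x.2 i)))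
    exact ⟨sub_nonneg.2 this.2, sub_le_self _ this.1⟩
  · have := hw i (ω i) (staffing (x.1 i) (rate i (x.2 i)))
    exact ⟨sub_nonneg.2 this.2, sub_le_self _ this.1⟩
  · refine (Finset.sum_le_card_nsmul _ _ ε fun i _ => ?_).trans (le_of_eq (by simp))
    rw [sub_sub_sub_cancel_left]
    exact hε i (ω i) _

end Staffing

open Filter Topology in
theorem theorem8 {L : ℕ} {Ω : Fin L → Type*} [∀ i, Fintype (Ω i)]
    (c : ∀ i, ℝ → Ω i → ℝ)
    (hc_cont : ∀ i s, ContinuousOn (fun b => c i b s) (Set.Ici 0))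
    (hc_mono : ∀ i s, StrictMonoOn (fun b => c i b s) (Set.Ici 0))
    (δ : ℝ) (hδ : 0 < δ)
    (p : (∀ i, Ω i) → ℝ) (hp_nonneg : ∀ ω, 0 ≤ p ω) (hp_sum : ∑ ω, p ω = 1)
    (rate₀ : ∀ i, Ω i → ℝ) (hrate₀ : ∀ i s, 0 < rate₀ i s)
    (f g : ℕ → (Fin L → ℝ) × (∀ i, Ω i) → ℝ)
    (hf : ∀ m, f m = Staffing.exactObjective c δ p (fun i s => (m : ℝ) * rate₀ i s))
    (hg : ∀ m, g m = Staffing.approxObjective c δ p (fun i s => (m : ℝ) * rate₀ i s))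
    (xF xG : ℕ → (Fin L → ℝ) × (∀ i, Ω i))
    (hxF : ∀ m, 1 ≤ m → Staffing.IsOptimal (f m) (xF m))
    (hxG : ∀ m, 1 ≤ m → Staffing.IsOptimal (g m) (xG m)) :
    Filter.Tendsto (fun m => f m (xG m) - f m (xF m)) Filter.atTop (nhds 0) := by
  rw [Metric.tendsto_atTop']
  intro ε hε
  -- Using `L + 1` covers `L = 0`.
  have hη : 0 < ε / (4 * δ * (L + 1)) := by positivity
  set η := ε / (4 * δ * (L + 1)) with hηdef
  have hηε : δ * (L * η) ≤ ε / 4 := by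
    have : δ * ((L + 1) * η) = ε / 4 := by rw [hηdef]; field_simp
    nlinarith
  have htend : ∀ i s, Tendsto (fun m : ℕ => (m : ℝ) * rate₀ i s) atTop atTop := fun i s =>
    tendsto_natCast_atTop_atTop.atTop_mul_const (hrate₀ i s)
  have hev : ∀ᶠ m : ℕ in atTop, ∀ i s, 1 ≤ (m : ℝ) * rate₀ i s ∧
      ∀ n, |Staffing.waitProb n (m * rate₀ i s) - Staffing.waitUpper n (m * rate₀ i s)| ≤ η :=
    -- Finitely many stations and scenarios share one threshold for `m`.
    eventually_all.2 fun i => eventually_all.2 fun s =>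
      ((htend i s).eventually_ge_atTop 1).and
        ((htend i s).eventually (Staffing.eventually_abs_waitProb_sub_waitUpper_le hη))
  obtain ⟨M, hM⟩ := eventually_atTop.1 (hev.and (eventually_ge_atTop 1))
  refine ⟨M, fun m hm => ?_⟩
  obtain ⟨hm1, hm2⟩ := hM m hm.le
  have hclose : ∀ x, |f m x - g m x| ≤ ε / 4 := fun x => by
    rw [hf, hg]
    exact (Staffing.abs_objective_sub_objective_le c hδ.le hp_nonneg hp_sum _
      (fun i s n => Staffing.waitProb_mem_Icc (by linarith [(hm1 i s).1]))
      (fun i s n => Staffing.waitUpper_mem_Icc (hm1 i s).1)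
      (fun i s n => (hm1 i s).2 n) x).trans hηε
  have h1 := abs_le.1 (hclose (xG m))
  have h2 := abs_le.1 (hclose (xF m))
  have h3 := (hxF m hm2).2 (xG m) (hxG m hm2).1
  have h4 := (hxG m hm2).2 (xF m) (hxF m hm2).1
  -- The gap is nonnegative by optimality of `xF m`, and `f(xG) ≤ g(xG) + ε/4 ≤ g(xF) + ε/4 ≤ f(xF)
  -- + ε/2`.
  rw [Real.dist_eq, sub_zero, abs_of_nonneg (by linarith)]
  linarith
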